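/- Let $\mathcal L$ be the set of first-order sentences (with equality) in the language $\{<\}$ of one binary relation symbol. Let $\mathrm{TI}$ be the theory consisting of the axioms of strict linear orders (irreflexivity, transitivity, trichotomy) together with the universal closures of all instances of the transfinite induction schema \[\forall x\,\bigl(\forall y\,(y<x\to\psi(y))\to\psi(x)\bigr)\to\forall x\,\psi(x),\] where $\psi$ ranges over all first-order formulas in the language $\{<\}$, possibly with further free variables as parameters. Structures are nonempty, as usual in first-order logic. Then for every sentence $\varphi\in\mathcal L$ the following are equivalent: (1) $\varphi$ holds in every (nonempty) well-ordered set $\langle L,<\rangle$; (2) $\varphi$ holds in $\langle\alpha,<\rangle$ for every ordinal $\alpha$ with $0<\alpha<\omega^\omega$; (3) $\varphi$ is provable from $\mathrm{TI}$ in classical first-order logic with equality. -/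

import Mathlib

/-!
By the completeness theorem, it suffices to show that every model `M` of `TI` agrees on sentences of
quantifier rank `k` with some ordinal `0 < α < ω ^ ω`. By the Ehrenfeucht–Fraïssé theorem, this is
a statement about depth-`k` types, which are finite in number and compose: the type of a sum of
orders is determined by the types of the summands. By a Ramsey argument, every order without a
maximum has a tail which is a cofinal concatenation of blocks of a single idempotent type `t`, and
the type of the tail is then determined by `t`; if `t` is the type of an ordinal `β`, the tail has
the type of `β * ω`. Hence, if all intervals ending below `x` have the types of ordinals below
`ω ^ ω`, then so do the intervals ending at `x`. As this property of `x` is definable, `TI` applies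
to it.
-/

universe u

namespace FirstOrder.Language

open FirstOrder

/-! ### A Hilbert-style proof calculus for classical first-order logic with equality -/

section Calculus

variable {L : Language.{0, 0}}

/-- The formula `φ(t)` obtained from `φ(x)`, where `x` is the unique in-scope bound variable,
by substituting the term `t` for `x`. -/
def BoundedFormula.instantiate (φ : L.BoundedFormula ℕ 1) (t : L.Term ℕ) : L.Formula ℕ :=
  φ.toFormula.subst (Sum.elim Term.var fun _ => t)

/-- `T.Derivable φ`: the formula `φ`, with free variables indexed by `ℕ`, has a formal derivation
from the set of sentences `T`. The primitive connectives are `⊥`, `⟹` and `∀'`. -/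
inductive Theory.Derivable (T : L.Theory) : L.Formula ℕ → Prop
  /-- sentences of `T` are axioms -/
  | ax (σ : L.Sentence) (h : σ ∈ T) :
      Theory.Derivable T (Formula.relabel (Empty.elim : Empty → ℕ) σ)
  /-- modus ponens -/
  | mp (φ ψ : L.Formula ℕ) (h₁ : Theory.Derivable T (φ ⟹ ψ)) (h₂ : Theory.Derivable T φ) :
      Theory.Derivable T ψ
  /-- the propositional axioms -/
  | impK (φ ψ : L.Formula ℕ) : Theory.Derivable T (φ ⟹ (ψ ⟹ φ))
  | impS (φ ψ χ : L.Formula ℕ) :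
      Theory.Derivable T ((φ ⟹ (ψ ⟹ χ)) ⟹ ((φ ⟹ ψ) ⟹ (φ ⟹ χ)))
  | dne (φ : L.Formula ℕ) : Theory.Derivable T (((φ ⟹ ⊥) ⟹ ⊥) ⟹ φ)
  /-- `∀ x, φ(x) → φ(t)` -/
  | allE (φ : L.BoundedFormula ℕ 1) (t : L.Term ℕ) :
      Theory.Derivable T ((∀' φ) ⟹ φ.instantiate t)
  /-- from `ψ → φ(x)` infer `ψ → ∀ x, φ(x)`, if `x` is not free in `ψ` and `∀ x, φ(x)` -/
  | gen (ψ : L.Formula ℕ) (φ : L.BoundedFormula ℕ 1) (x : ℕ)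
      (hψ : x ∉ ψ.freeVarFinset) (hφ : x ∉ φ.freeVarFinset)
      (h : Theory.Derivable T (ψ ⟹ φ.instantiate (Term.var x))) :
      Theory.Derivable T (ψ ⟹ ∀' φ)
  /-- the equality axioms `t = t` and `s = t → φ(s) → φ(t)` -/
  | eqRefl (t : L.Term ℕ) : Theory.Derivable T (t.equal t)
  | eqSubst (φ : L.BoundedFormula ℕ 1) (s t : L.Term ℕ) :
      Theory.Derivable T (s.equal t ⟹ (φ.instantiate s ⟹ φ.instantiate t))

/-- `T ⊢ σ` for a sentence `σ`. -/
def Theory.Proves (T : L.Theory) (σ : L.Sentence) : Prop :=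
  T.Derivable (Formula.relabel (Empty.elim : Empty → ℕ) σ)

end Calculus

/-! ### The language `{<}` and its structures -/

/-- The relation symbols of the language `{<}`: a single binary one. -/
inductive StrictOrderRel : ℕ → Type
  | lt : StrictOrderRel 2

/-- The first-order language `{<}`. -/
def strictOrder : Language.{0, 0} := ⟨fun _ => Empty, StrictOrderRel⟩

/-- The symbol `<`. -/
def ltSymb : strictOrder.Relations 2 := StrictOrderRel.lt

/-- A type with a relation `<` is a structure for the language `{<}`. -/
instance strictOrderStructure (M : Type u) [LT M] : strictOrder.Structure M where
  funMap f := f.elim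
  RelMap | .lt => fun x => x 0 < x 1

/-! ### The theories of linear orders and of transfinite induction -/

/-- The theory of strict linear orders: irreflexivity, transitivity, trichotomy. -/
def strictLinearOrderTheory : strictOrder.Theory :=
  {ltSymb.irreflexive, ltSymb.transitive,
    ∀' ∀' (ltSymb.boundedFormula₂ (&0) &1 ⊔ (Term.bdEqual (&0) &1 ⊔
      ltSymb.boundedFormula₂ (&1) &0))}

/-- The universal closure of
`(∀ x, (∀ y, y < x → φ(y)) → φ(x)) → ∀ x, φ(x)`, where `φ` has the variables `0, …, n`, of which
`0, …, n - 1` are parameters and `n` is `x`. Inside, `y` is the variable `n + 1`, and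
`φ.liftAt 1 n` is `φ(y)`. -/
def transfiniteInduction {n : ℕ} (φ : strictOrder.BoundedFormula Empty (n + 1)) :
    strictOrder.Sentence :=
  BoundedFormula.alls (n := n)
    ((∀' ((∀' (ltSymb.boundedFormula₂ (&(Fin.last (n + 1))) (&(Fin.last n).castSucc) ⟹
        φ.liftAt 1 n)) ⟹ φ)) ⟹ ∀' φ)

/-- The theory `TI`: linear orders together with the transfinite induction schema for all
formulas with parameters. -/
def transfiniteInductionTheory : strictOrder.Theory :=
  strictLinearOrderTheory ∪
    {σ | ∃ (n : ℕ) (φ : strictOrder.BoundedFormula Empty (n + 1)), σ = transfiniteInduction φ}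

end FirstOrder.Language

open Set FirstOrder Language

/-! ### Soundness of the calculus -/

section Soundness

variable {L : FirstOrder.Language.{0, 0}} {M : Type*} [L.Structure M] {T : L.Theory}

theorem realize_instantiate (φ : L.BoundedFormula ℕ 1) (t : L.Term ℕ) (v : ℕ → M) :
    (φ.instantiate t).Realize v ↔ φ.Realize v fun _ => t.realize v := by
  rw [BoundedFormula.instantiate, Formula.Realize, BoundedFormula.realize_subst]
  exact BoundedFormula.realize_toFormula φ _

theorem realize_all_iff (φ : L.BoundedFormula ℕ 1) (v : ℕ → M) :
    Formula.Realize (∀' φ) v ↔ ∀ a, φ.Realize v fun _ => a :=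
  forall_congr' fun a => iff_of_eq <| congrArg _ <| funext fun i => by
    rw [Fin.eq_zero i]
    rfl

theorem realize_congr_of_eqOn {n : ℕ} (φ : L.BoundedFormula ℕ n) {v w : ℕ → M}
    (h : EqOn v w φ.freeVarFinset) (xs : Fin n → M) : φ.Realize v xs ↔ φ.Realize w xs := by
  rw [← BoundedFormula.realize_restrictFreeVar' (s := φ.freeVarFinset) subset_rfl,
    ← BoundedFormula.realize_restrictFreeVar' (s := φ.freeVarFinset) (v := w) subset_rfl]
  exact iff_of_eq (congrArg₂ _ (funext fun x => h x.2) rfl)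

theorem realize_update_iff {n : ℕ} (φ : L.BoundedFormula ℕ n) {x : ℕ}
    (hx : x ∉ φ.freeVarFinset) (v : ℕ → M) (a : M) (xs : Fin n → M) :
    φ.Realize (Function.update v x a) xs ↔ φ.Realize v xs :=
  realize_congr_of_eqOn φ
    (fun _ hy => Function.update_of_ne (ne_of_mem_of_not_mem hy hx) _ _) xs

theorem realize_relabel_elim (σ : L.Sentence) (v : ℕ → M) :
    (Formula.relabel (Empty.elim : Empty → ℕ) σ).Realize v ↔ M ⊨ σ := by
  rw [Formula.realize_relabel, Subsingleton.elim (v ∘ Empty.elim) default]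
  rfl

theorem realize_of_derivable [M ⊨ T] {φ : L.Formula ℕ} (h : T.Derivable φ)
    (v : ℕ → M) : φ.Realize v := by
  induction h generalizing v with
  | ax σ h => exact (realize_relabel_elim σ v).2 (T.realize_sentence_of_mem h)
  | mp _ _ _ _ ih₁ ih₂ => exact ih₁ v (ih₂ v)
  | impK φ ψ => exact fun h _ => h
  | impS φ ψ χ => exact fun h h' h'' => h h'' (h' h'')
  | dne φ => exact fun h => not_not.1 h
  | allE φ t =>
    exact fun h => (realize_instantiate φ t v).2 ((realize_all_iff φ v).1 h (t.realize v))
  | gen ψ φ x hψ hφ _ ih =>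
    refine fun h => (realize_all_iff φ v).2 fun a => ?_
    have hx := ih (Function.update v x a) ((realize_update_iff ψ hψ v a _).2 h)
    simpa only [Term.realize_var, Function.update_self, realize_update_iff φ hφ] using
      (realize_instantiate φ _ _).1 hx
  | eqRefl t => exact Formula.realize_equal.2 rfl
  | eqSubst φ s t =>
    refine fun hst h => (realize_instantiate φ t v).2 ?_
    rw [← Formula.realize_equal.1 hst]
    exact (realize_instantiate φ s v).1 h

end Soundness

/-! ### Henkin sets -/

section Henkin

variable {L : FirstOrder.Language.{0, 0}} {T : L.Theory} {φ ψ χ θ : L.Formula ℕ}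

/-- Implication between formulas is derivable from `T`. -/
def Entails (T : L.Theory) (φ ψ : L.Formula ℕ) : Prop := T.Derivable (φ ⟹ ψ)

namespace Entails

theorem of_derivable (h : T.Derivable ψ) (φ : L.Formula ℕ) : Entails T φ ψ :=
  .mp _ _ (.impK ψ φ) h

theorem mp (h : Entails T θ (φ ⟹ ψ)) (h' : Entails T θ φ) : Entails T θ ψ :=
  Theory.Derivable.mp _ _ (.mp _ _ (.impS θ φ ψ) h) h'

theorem refl (φ : L.Formula ℕ) : Entails T φ φ :=
  mp (.impK φ (φ ⟹ φ)) (.impK φ φ)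

theorem trans (h : Entails T φ ψ) (h' : Entails T ψ χ) : Entails T φ χ :=
  mp (of_derivable h' φ) h

theorem imp_right (h : Entails T φ ψ) (θ : L.Formula ℕ) : Entails T (θ ⟹ φ) (θ ⟹ ψ) :=
  Theory.Derivable.mp _ _ (.impS θ φ ψ) (of_derivable h θ)

theorem imp_left (h : Entails T φ ψ) (χ : L.Formula ℕ) : Entails T (ψ ⟹ χ) (φ ⟹ χ) :=
  mp (trans (.impK (ψ ⟹ χ) φ) (.impS φ ψ χ)) (of_derivable h _)

theorem of_not_not (φ : L.Formula ℕ) : Entails T (∼(∼φ)) φ :=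
  Theory.Derivable.dne φ

theorem bot_left (φ : L.Formula ℕ) : Entails T ⊥ φ :=
  trans (.impK ⊥ (∼φ)) (of_not_not φ)

theorem imp_of_not (φ ψ : L.Formula ℕ) : Entails T (∼φ) (φ ⟹ ψ) :=
  (bot_left ψ).imp_right φ

theorem inf_left (φ ψ : L.Formula ℕ) : Entails T (φ ⊓ ψ) φ :=
  ((imp_of_not φ (∼ψ)).imp_left ⊥).trans (of_not_not φ)

theorem inf_right (φ ψ : L.Formula ℕ) : Entails T (φ ⊓ ψ) ψ :=
  (imp_left (.impK (∼ψ) φ) ⊥).trans (of_not_not ψ)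

theorem not_of_inf_bot (h : Entails T (φ ⊓ ψ) ⊥) : Entails T φ (∼ψ) :=
  Theory.Derivable.mp _ _ (.dne _) h

end Entails

/-- The formulas consistent with `T`, ordered with the stronger formulas above the weaker ones. -/
def ConsistentFormula (T : L.Theory) : Type := {φ : L.Formula ℕ // ¬ Entails T φ ⊥}

instance : Preorder (ConsistentFormula T) where
  le φ ψ := Entails T ψ.1 φ.1
  le_refl φ := .refl φ.1
  le_trans _ _ _ h h' := h'.trans h

/-- A maximal consistent set of formulas containing a counterexample to each universal formula
it refutes. -/
structure IsHenkin (T : L.Theory) (H : Set (L.Formula ℕ)) : Prop where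
  of_derivable : ∀ {φ}, T.Derivable φ → φ ∈ H
  mp : ∀ {φ ψ}, (φ ⟹ ψ) ∈ H → φ ∈ H → ψ ∈ H
  bot_notMem : ⊥ ∉ H
  mem_or_neg_mem : ∀ φ, φ ∈ H ∨ ∼φ ∈ H
  exists_instantiate_notMem : ∀ φ : L.BoundedFormula ℕ 1, (∀' φ) ∉ H → ∃ t, φ.instantiate t ∉ H

/-- The formula `ψ` decides `θ`, with a counterexample if `θ` is a universal formula that it
refutes. -/
def Decides (T : L.Theory) (ψ θ : L.Formula ℕ) : Prop :=
  Entails T ψ θ ∨ Entails T ψ (∼θ) ∧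
    ∀ φ : L.BoundedFormula ℕ 1, θ = ∀' φ → ∃ t, Entails T ψ (∼(φ.instantiate t))

theorem exists_inf_not_instantiate_consistent (hψ : ¬ Entails T ψ ⊥) {φ : L.BoundedFormula ℕ 1}
    (h : Entails T ψ (∼(∀' φ))) : ∃ t, ¬ Entails T (ψ ⊓ ∼(φ.instantiate t)) ⊥ := by
  obtain ⟨x, hx⟩ := Infinite.exists_notMem_finset (ψ.freeVarFinset ∪ φ.freeVarFinset)
  rw [Finset.mem_union, not_or] at hx
  refine ⟨Term.var x, fun h' => hψ (h.mp ?_)⟩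
  exact Theory.Derivable.gen _ _ x hx.1 hx.2 (h'.not_of_inf_bot.trans (.of_not_not _))

/-- The consistent formulas that decide `θ`, as a requirement for the generic filter of the
Rasiowa–Sikorski lemma. -/
def deciding (T : L.Theory) (θ : L.Formula ℕ) : Order.Cofinal (ConsistentFormula T) where
  carrier := {ψ | Decides T ψ.1 θ}
  isCofinal ψ := by
    by_cases h : Entails T ψ.1 (∼θ)
    · by_cases hθ : ∃ φ : L.BoundedFormula ℕ 1, θ = ∀' φ
      · obtain ⟨φ, rfl⟩ := hθ
        obtain ⟨t, ht⟩ := exists_inf_not_instantiate_consistent ψ.2 h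
        refine ⟨⟨_, ht⟩, .inr ⟨(Entails.inf_left _ _).trans h, ?_⟩, Entails.inf_left _ _⟩
        rintro _ ⟨⟩
        exact ⟨t, Entails.inf_right _ _⟩
      · exact ⟨ψ, .inr ⟨h, fun φ hφ => (hθ ⟨φ, hφ⟩).elim⟩, le_rfl⟩
    · exact ⟨⟨ψ.1 ⊓ θ, fun h' => h h'.not_of_inf_bot⟩, .inl (Entails.inf_right _ _),
        Entails.inf_left _ _⟩

theorem exists_isHenkin [Countable (L.Formula ℕ)] (hψ : ¬ Entails T ψ ⊥) :
    ∃ H, IsHenkin T H ∧ ψ ∈ H := by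
  have := Encodable.ofCountable (L.Formula ℕ)
  let p : ConsistentFormula T := ⟨ψ, hψ⟩
  let I := Order.idealOfCofinals p (deciding T)
  have hψI : p ∈ I := Order.mem_idealOfCofinals _ _
  have hdec (θ) : ∃ χ ∈ I, Decides T χ.1 θ :=
    let ⟨χ, h, hχ⟩ := Order.cofinal_meets_idealOfCofinals _ (deciding T) θ
    ⟨χ, hχ, h⟩
  let H : Set (L.Formula ℕ) := {φ | ∃ χ ∈ I, Entails T χ.1 φ}
  have hmp {φ ψ} : (φ ⟹ ψ) ∈ H → φ ∈ H → ψ ∈ H := by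
    rintro ⟨χ₁, h₁, h₁'⟩ ⟨χ₂, h₂, h₂'⟩
    obtain ⟨χ, h, hχ₁, hχ₂⟩ := I.directed χ₁ h₁ χ₂ h₂
    exact ⟨χ, h, (Entails.trans hχ₁ h₁').mp (Entails.trans hχ₂ h₂')⟩
  have hbot : ⊥ ∉ H := fun ⟨χ, _, h⟩ => χ.2 h
  refine ⟨H, ⟨fun h => ⟨_, hψI, .of_derivable h _⟩, hmp, hbot, fun φ => ?_, fun φ hφ => ?_⟩,
    _, hψI, .refl _⟩
  · obtain ⟨χ, hχ, h⟩ := hdec φ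
    exact h.imp (fun h => ⟨χ, hχ, h⟩) fun h => ⟨χ, hχ, h.1⟩
  · obtain ⟨χ, hχ, h | ⟨-, h⟩⟩ := hdec (∀' φ)
    · exact (hφ ⟨χ, hχ, h⟩).elim
    · obtain ⟨t, ht⟩ := h φ rfl
      exact ⟨t, fun hn => hbot (hmp ⟨χ, hχ, ht⟩ hn)⟩

end Henkin

/-! ### Substitution and quantifier rank -/

section Substitution

variable {L L' : FirstOrder.Language} {α β γ : Type*}

theorem subst_relabel (t : L.Term α) (g : α → β) (f : β → L.Term γ) :
    (t.relabel g).subst f = t.subst (f ∘ g) := by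
  induction t with
  | var => rfl
  | func F _ ih => exact congrArg (Term.func F) (funext ih)

theorem relabel_subst (t : L.Term α) (f : α → L.Term β) (g : β → γ) :
    (t.subst f).relabel g = t.subst (Term.relabel g ∘ f) := by
  induction t with
  | var => rfl
  | func F _ ih => exact congrArg (Term.func F) (funext ih)

theorem subst_var (t : L.Term α) : t.subst Term.var = t := by
  induction t with
  | var => rfl
  | func F _ ih => exact congrArg (Term.func F) (funext ih)

theorem relabel_inl_subst (t : L.Term α) (f : β → L.Term α) :
    (t.relabel Sum.inl).subst (Sum.elim Term.var f) = t := by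
  rw [subst_relabel, Sum.elim_comp_inl, subst_var]

theorem exists_relabel_inl_eq (t : L.Term (α ⊕ Fin 0)) : ∃ s : L.Term α, s.relabel Sum.inl = t := by
  refine ⟨t.relabel (Sum.elim id Fin.elim0), ?_⟩
  have h : Sum.inl ∘ Sum.elim id Fin.elim0 = (id : α ⊕ Fin 0 → α ⊕ Fin 0) :=
    funext (Sum.forall.2 ⟨fun _ => rfl, fun i => i.elim0⟩)
  rw [Term.relabel_relabel, h, Term.relabel_id]

theorem relabel_inl_subst_eq_relabel_subst (t : L.Term α) (f : α → L.Term β)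
    (g : γ → L.Term (β ⊕ γ)) : (t.relabel Sum.inl).subst (Sum.elim (Term.relabel Sum.inl ∘ f) g) =
      (t.subst f).relabel Sum.inl := by
  rw [subst_relabel, Sum.elim_comp_inl, relabel_subst]

/-- The quantifier rank of a formula: the maximal nesting of its quantifiers. -/
def quantifierRank : ∀ {n : ℕ}, L.BoundedFormula α n → ℕ
  | _, .falsum => 0
  | _, .equal _ _ => 0
  | _, .rel _ _ => 0
  | _, .imp φ ψ => max (quantifierRank φ) (quantifierRank ψ)
  | _, .all φ => quantifierRank φ + 1

theorem quantifierRank_castLE {m n : ℕ} (h : m ≤ n) (φ : L.BoundedFormula α m) :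
    quantifierRank (φ.castLE h) = quantifierRank φ := by
  induction φ generalizing n with
  | falsum => rfl
  | equal => rfl
  | rel => rfl
  | imp φ ψ ih₁ ih₂ => exact congrArg₂ max (ih₁ h) (ih₂ h)
  | all φ ih => exact congrArg (· + 1) (ih _)

theorem quantifierRank_mapTermRel {g : ℕ → ℕ}
    (ft : ∀ n, L.Term (α ⊕ Fin n) → L'.Term (β ⊕ Fin (g n)))
    (fr : ∀ n, L.Relations n → L'.Relations n)
    (h : ∀ n, L'.BoundedFormula β (g (n + 1)) → L'.BoundedFormula β (g n + 1))
    (hh : ∀ n φ, quantifierRank (h n φ) = quantifierRank φ) {n : ℕ} (φ : L.BoundedFormula α n) :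
    quantifierRank (φ.mapTermRel ft fr h) = quantifierRank φ := by
  induction φ with
  | falsum => rfl
  | equal => rfl
  | rel => rfl
  | imp φ ψ ih₁ ih₂ => exact congrArg₂ max ih₁ ih₂
  | all φ ih => exact congrArg (· + 1) ((hh _ _).trans ih)

theorem quantifierRank_relabel {m n : ℕ} (g : α → β ⊕ Fin m) (φ : L.BoundedFormula α n) :
    quantifierRank (φ.relabel g) = quantifierRank φ :=
  quantifierRank_mapTermRel _ _ _ (fun _ _ => quantifierRank_castLE _ _) φ

theorem quantifierRank_toFormula {n : ℕ} (φ : L.BoundedFormula α n) :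
    quantifierRank φ.toFormula = quantifierRank φ := by
  induction φ with
  | falsum => rfl
  | equal => rfl
  | rel => rfl
  | imp φ ψ ih₁ ih₂ => exact congrArg₂ max ih₁ ih₂
  | all φ ih => exact congrArg (· + 1) ((quantifierRank_relabel _ _).trans ih)

theorem quantifierRank_instantiate {L : FirstOrder.Language.{0, 0}} (φ : L.BoundedFormula ℕ 1)
    (t : L.Term ℕ) : quantifierRank (φ.instantiate t) = quantifierRank φ :=
  (quantifierRank_mapTermRel (g := id) _ _ _ (fun _ _ => rfl) φ.toFormula).trans
    (quantifierRank_toFormula φ)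

theorem instantiate_bdEqual {L : FirstOrder.Language.{0, 0}} (s t : L.Term (ℕ ⊕ Fin 1))
    (u : L.Term ℕ) : (s.bdEqual t).instantiate u = (s.subst (Sum.elim Term.var fun _ => u)).equal
      (t.subst (Sum.elim Term.var fun _ => u)) :=
  congrArg₂ Term.bdEqual (relabel_inl_subst_eq_relabel_subst s _ _)
    (relabel_inl_subst_eq_relabel_subst t _ _)

theorem instantiate_rel {L : FirstOrder.Language.{0, 0}} {n : ℕ} (R : L.Relations n)
    (ts : Fin n → L.Term (ℕ ⊕ Fin 1)) (u : L.Term ℕ) :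
    (R.boundedFormula ts).instantiate u =
      R.formula fun i => (ts i).subst (Sum.elim Term.var fun _ => u) :=
  congrArg (BoundedFormula.rel R) (funext fun i => relabel_inl_subst_eq_relabel_subst (ts i) _ _)

theorem update_relabel_inl_subst {n : ℕ} (ts : Fin n → L.Term α) (i : Fin n) (u : L.Term α) :
    (fun j => (Function.update (fun j => (ts j).relabel Sum.inl) i (Term.var (Sum.inr 0)) j).subst
      (Sum.elim Term.var fun _ : Fin 1 => u)) = Function.update ts i u := by
  funext j
  rcases eq_or_ne j i with rfl | hj
  · rw [Function.update_self, Function.update_self]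
    rfl
  · rw [Function.update_of_ne hj, Function.update_of_ne hj, relabel_inl_subst]

end Substitution

/-! ### The term model and the completeness theorem -/

section Completeness

variable {L : FirstOrder.Language.{0, 0}} {T : L.Theory} {H : Set (L.Formula ℕ)} {n : ℕ}

namespace IsHenkin

theorem imp_mem_iff (h : IsHenkin T H) {φ ψ : L.Formula ℕ} :
    (φ ⟹ ψ) ∈ H ↔ (φ ∈ H → ψ ∈ H) := by
  refine ⟨h.mp, fun h' => ?_⟩
  rcases h.mem_or_neg_mem φ with hφ | hφ
  · exact h.mp (h.of_derivable (.impK ψ φ)) (h' hφ)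
  · exact h.mp (h.of_derivable (Entails.imp_of_not φ ψ)) hφ

theorem all_mem_iff (h : IsHenkin T H) {φ : L.BoundedFormula ℕ 1} :
    (∀' φ) ∈ H ↔ ∀ t, φ.instantiate t ∈ H := by
  refine ⟨fun h' t => h.mp (h.of_derivable (.allE φ t)) h', fun h' => by_contra fun hn => ?_⟩
  obtain ⟨t, ht⟩ := h.exists_instantiate_notMem φ hn
  exact ht (h' t)

theorem instantiate_mem_of_equal_mem (h : IsHenkin T H) (φ : L.BoundedFormula ℕ 1)
    {s t : L.Term ℕ} (hst : s.equal t ∈ H) (hs : φ.instantiate s ∈ H) : φ.instantiate t ∈ H :=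
  h.mp (h.mp (h.of_derivable (.eqSubst φ s t)) hst) hs

theorem equal_self_mem (h : IsHenkin T H) (t : L.Term ℕ) : t.equal t ∈ H :=
  h.of_derivable (.eqRefl t)

theorem equal_subst_mem (h : IsHenkin T H) {s t u : L.Term ℕ}
    (r : L.Term (ℕ ⊕ Fin 1)) (hst : s.equal t ∈ H)
    (hs : u.equal (r.subst (Sum.elim Term.var fun _ => s)) ∈ H) :
    u.equal (r.subst (Sum.elim Term.var fun _ => t)) ∈ H := by
  have := h.instantiate_mem_of_equal_mem ((u.relabel Sum.inl).bdEqual r) hst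
  simp only [instantiate_bdEqual, relabel_inl_subst] at this
  exact this hs

theorem equal_symm (h : IsHenkin T H) {s t : L.Term ℕ} (hst : s.equal t ∈ H) :
    t.equal s ∈ H := by
  have := h.instantiate_mem_of_equal_mem (Term.bdEqual (&0) (s.relabel Sum.inl)) hst
  simp only [instantiate_bdEqual, relabel_inl_subst] at this
  exact this (h.equal_self_mem s)

theorem equal_trans (h : IsHenkin T H) {s t u : L.Term ℕ} (hst : s.equal t ∈ H)
    (htu : t.equal u ∈ H) : s.equal u ∈ H :=
  h.equal_subst_mem (&0) htu hst

/-- Terms are identified when the Henkin set contains their equality. -/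
def setoid (h : IsHenkin T H) : Setoid (L.Term ℕ) :=
  ⟨fun s t => s.equal t ∈ H, h.equal_self_mem, h.equal_symm, h.equal_trans⟩

theorem of_forall_equal_mem {P : (Fin n → L.Term ℕ) → Prop}
    (hP : ∀ us i (s t : L.Term ℕ), s.equal t ∈ H → P (Function.update us i s) →
      P (Function.update us i t))
    {ss ts : Fin n → L.Term ℕ} (hst : ∀ i, (ss i).equal (ts i) ∈ H) (hs : P ss) : P ts := by
  suffices h : ∀ F : Finset (Fin n), P (F.piecewise ts ss) by simpa using h Finset.univ
  intro F
  induction F using Finset.induction_on with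
  | empty => simpa using hs
  | insert i F hi ih =>
    rw [Finset.piecewise_insert]
    refine hP _ i _ _ (hst i) ?_
    rwa [← Finset.piecewise_eq_of_notMem F ts ss hi, Function.update_eq_self]

theorem func_equal_mem (h : IsHenkin T H) (f : L.Functions n) {ss ts : Fin n → L.Term ℕ}
    (hst : ∀ i, (ss i).equal (ts i) ∈ H) : (Term.func f ss).equal (Term.func f ts) ∈ H := by
  refine of_forall_equal_mem (P := fun us => (Term.func f ss).equal (Term.func f us) ∈ H)
    (fun us i s t hst hs => ?_) hst (h.equal_self_mem _)
  rw [← update_relabel_inl_subst] at hs ⊢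
  exact h.equal_subst_mem (Term.func f _) hst hs

theorem rel_mem_of_equal_mem (h : IsHenkin T H) (R : L.Relations n) {ss ts : Fin n → L.Term ℕ}
    (hst : ∀ i, (ss i).equal (ts i) ∈ H) (hs : R.formula ss ∈ H) : R.formula ts ∈ H := by
  refine of_forall_equal_mem (P := fun us => R.formula us ∈ H) (fun us i s t hst hs => ?_) hst hs
  rw [← update_relabel_inl_subst, ← instantiate_rel] at hs ⊢
  exact h.instantiate_mem_of_equal_mem _ hst hs

instance prestructure (h : IsHenkin T H) : L.Prestructure h.setoid where
  toStructure := ⟨Term.func, fun R ts => R.formula ts ∈ H⟩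
  fun_equiv _ _ hst := h.func_equal_mem _ hst
  rel_equiv _ _ hst := propext
    ⟨h.rel_mem_of_equal_mem _ hst, h.rel_mem_of_equal_mem _ fun i => h.equal_symm (hst i)⟩

/-- The term model of a Henkin set. -/
abbrev TermModel (h : IsHenkin T H) : Type := Quotient h.setoid

/-- The valuation sending each variable to its class in the term model. -/
def valuation (h : IsHenkin T H) (x : ℕ) : h.TermModel := Quotient.mk _ (Term.var x)

instance (h : IsHenkin T H) : Nonempty h.TermModel := ⟨h.valuation 0⟩

theorem realize_valuation (h : IsHenkin T H) (t : L.Term ℕ) :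
    t.realize h.valuation = Quotient.mk h.setoid t := by
  induction t with
  | var => rfl
  | func f ts ih =>
    exact (congrArg (Structure.funMap f) (funext ih)).trans (funMap_quotient_mk' h.setoid f ts)

theorem mem_iff_realize (h : IsHenkin T H) : ∀ φ : L.Formula ℕ, φ ∈ H ↔ φ.Realize h.valuation
  | .falsum => iff_of_false h.bot_notMem id
  | .equal t₁ t₂ => by
    obtain ⟨s₁, rfl⟩ := exists_relabel_inl_eq t₁
    obtain ⟨s₂, rfl⟩ := exists_relabel_inl_eq t₂
    change s₁.equal s₂ ∈ H ↔ (s₁.equal s₂).Realize h.valuation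
    rw [Formula.realize_equal, h.realize_valuation, h.realize_valuation, Quotient.eq]
    rfl
  | .rel R ts => by
    choose ss hss using fun i => exists_relabel_inl_eq (ts i)
    obtain rfl := funext hss
    change R.formula ss ∈ H ↔ (R.formula ss).Realize h.valuation
    simp only [Formula.realize_rel, h.realize_valuation]
    exact (relMap_quotient_mk' h.setoid R ss).symm
  | .imp φ ψ => h.imp_mem_iff.trans (imp_congr (h.mem_iff_realize φ) (h.mem_iff_realize ψ))
  | .all φ => by
    rw [h.all_mem_iff]
    have ih (t : L.Term ℕ) : φ.instantiate t ∈ H ↔ φ.Realize h.valuation fun _ => ⟦t⟧ := by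
      rw [h.mem_iff_realize, realize_instantiate, h.realize_valuation]
    simp only [ih]
    exact (Quotient.forall (p := fun a => φ.Realize h.valuation fun _ => a)).symm.trans
      (realize_all_iff φ _).symm
termination_by φ => (quantifierRank φ, sizeOf φ)
decreasing_by
  · exact .right' _ (le_max_left _ _) (by simp +arith)
  · exact .right' _ (le_max_right _ _) (by simp +arith)
  · exact .left _ _ ((quantifierRank_instantiate φ t).trans_lt (Nat.lt_succ_self _))

theorem model_termModel (h : IsHenkin T H) : h.TermModel ⊨ T :=
  ⟨fun σ hσ => (realize_relabel_elim σ h.valuation).1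
    ((h.mem_iff_realize _).1 (h.of_derivable (.ax σ hσ)))⟩

end IsHenkin

theorem realize_of_proves {σ : L.Sentence} (h : T.Proves σ) (M : Type*) [L.Structure M]
    [Nonempty M] [M ⊨ T] : M ⊨ σ :=
  (realize_relabel_elim σ fun _ => Classical.arbitrary M).1 (realize_of_derivable h _)

theorem proves_iff_models [Countable L.Symbols] {σ : L.Sentence} :
    T.Proves σ ↔ T ⊨ᵇ σ := by
  rw [Theory.models_sentence_iff]
  refine ⟨fun h M => realize_of_proves h M, fun h => by_contra fun hσ => ?_⟩
  let σ' : L.Formula ℕ := Formula.relabel (Empty.elim : Empty → ℕ) σ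
  have hcons : ¬ Entails T (∼σ') ⊥ := fun h' => hσ (.mp _ _ (.dne _) h')
  obtain ⟨H, hH, hmem⟩ := exists_isHenkin hcons
  have := hH.model_termModel
  exact (hH.mem_iff_realize _).1 hmem
    ((realize_relabel_elim σ hH.valuation).2 (h (Theory.ModelType.of T hH.TermModel)))

end Completeness

/-! ### Depth types and their composition -/

section DepthType

/-- The possible values of the depth-`k` type of a linearly ordered set (see `depthType`). -/
def DepthType : ℕ → Type
  | 0 => Unit
  | k + 1 => Set (DepthType k × DepthType k)

instance DepthType.finite : ∀ k, Finite (DepthType k)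
  | 0 => inferInstanceAs (Finite Unit)
  | k + 1 =>
    have := DepthType.finite k
    inferInstanceAs (Finite (Set (DepthType k × DepthType k)))

variable {M N : Type*} [LinearOrder M] [LinearOrder N] {k : ℕ}

/-- The depth-`k` type of a subset of a linear order: at depth `k + 1` it records the depth-`k`
types of the two parts into which each of its points cuts the set. Two sets have equal types iff
Duplicator wins the Ehrenfeucht–Fraïssé game of length `k` between them. -/
def depthType : (k : ℕ) → Set M → DepthType k
  | 0, _ => ()
  | k + 1, S => S.image fun x => (depthType k (S ∩ Iio x), depthType k (S ∩ Ioi x))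

/-- The depth-`k` types of the parts of `S` to the left and to the right of `x`. -/
def cutType (k : ℕ) (S : Set M) (x : M) : DepthType k × DepthType k :=
  (depthType k (S ∩ Iio x), depthType k (S ∩ Ioi x))

theorem depthType_succ (k : ℕ) (S : Set M) : depthType (k + 1) S = cutType k S '' S := rfl

theorem exists_cutType_eq_of_depthType_succ_eq {S : Set M} {T : Set N}
    (h : depthType (k + 1) S = depthType (k + 1) T) {x : M} (hx : x ∈ S) :
    ∃ y ∈ T, cutType k T y = cutType k S x := by
  rw [depthType_succ, depthType_succ] at h
  exact (h ▸ mem_image_of_mem _ hx : cutType k S x ∈ cutType k T '' T)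

theorem depthType_empty (k : ℕ) : depthType k (∅ : Set M) = depthType k (∅ : Set N) := by
  cases k with
  | zero => rfl
  | succ k => rw [depthType_succ, depthType_succ, image_empty, image_empty]

theorem depthType_image (f : M ↪o N) (k : ℕ) (S : Set M) :
    depthType k (f '' S) = depthType k S := by
  induction k generalizing S with
  | zero => rfl
  | succ k ih =>
    rw [depthType_succ, depthType_succ, image_image]
    refine image_congr fun x _ => ?_
    rw [cutType, ← image_inter_preimage, ← image_inter_preimage, f.preimage_Iio, f.preimage_Ioi,
      ih, ih, cutType]

theorem depthType_singleton (k : ℕ) (x : M) (y : N) :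
    depthType k {x} = depthType k {y} := by
  cases k with
  | zero => rfl
  | succ k =>
    rw [depthType_succ, depthType_succ, image_singleton, image_singleton, cutType, cutType]
    simp only [singleton_inter_of_notMem, mem_Iio, mem_Ioi, lt_self_iff_false, not_false_iff]
    rw [depthType_empty (M := M) (N := N)]

namespace DepthType

/-- The depth-`k` type determined by a type of depth `k + 1` (see `truncate_depthType`). -/
def truncate : {k : ℕ} → DepthType (k + 1) → DepthType k
  | 0, _ => ()
  | _ + 1, t => image (Prod.map truncate truncate) t

/-- The type of a set `S` followed by a set `T`, in terms of their types
(see `depthType_union`). -/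
protected def append : {k : ℕ} → DepthType k → DepthType k → DepthType k
  | 0, _, _ => ()
  | k + 1, s, t =>
    ((fun p => (p.1, p.2.append t.truncate)) '' s ∪
      (fun p => (s.truncate.append p.1, p.2)) '' t : Set (DepthType k × DepthType k))

instance : Append (DepthType k) := ⟨DepthType.append⟩

/-- The type of an `ω`-like concatenation of sets whose common type `t` is idempotent
(see `HasCofinalBlocks.depthType_eq`). -/
def omega : {k : ℕ} → DepthType k → DepthType k
  | 0, _ => ()
  | _ + 1, t => (fun p => (p.1, p.2 ++ t.truncate.omega)) '' t

end DepthType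

open DepthType

theorem append_succ (s t : DepthType (k + 1)) :
    s ++ t = ((fun p => (p.1, p.2 ++ t.truncate)) '' s ∪
      (fun p => (s.truncate ++ p.1, p.2)) '' t : Set (DepthType k × DepthType k)) := rfl

theorem truncate_depthType (k : ℕ) (S : Set M) :
    (depthType (k + 1) S).truncate = depthType k S := by
  induction k generalizing S with
  | zero => rfl
  | succ k ih =>
    rw [depthType_succ k, truncate, depthType_succ, image_image]
    refine image_congr fun x _ => ?_
    rw [cutType, Prod.map, ih, ih, cutType]

theorem depthType_eq_of_succ {S : Set M} {T : Set N}
    (h : depthType (k + 1) S = depthType (k + 1) T) : depthType k S = depthType k T := by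
  rw [← truncate_depthType, h, truncate_depthType]

theorem cutType_union_left {S T : Set M} (h : ∀ x ∈ S, ∀ y ∈ T, x < y) {x : M} (hx : x ∈ S) :
    cutType k (S ∪ T) x = (depthType k (S ∩ Iio x), depthType k (S ∩ Ioi x ∪ T)) := by
  have hT : T ∩ Iio x = ∅ := eq_empty_of_forall_notMem fun y hy => (h x hx y hy.1).asymm hy.2
  have hT' : T ∩ Ioi x = T := inter_eq_left.2 fun y hy => h x hx y hy
  rw [cutType, union_inter_distrib_right, union_inter_distrib_right, hT, hT', union_empty]

theorem cutType_union_right {S T : Set M} (h : ∀ x ∈ S, ∀ y ∈ T, x < y) {y : M} (hy : y ∈ T) :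
    cutType k (S ∪ T) y = (depthType k (S ∪ T ∩ Iio y), depthType k (T ∩ Ioi y)) := by
  have hS : S ∩ Iio y = S := inter_eq_left.2 fun x hx => h x hx y hy
  have hS' : S ∩ Ioi y = ∅ := eq_empty_of_forall_notMem fun x hx => (h x hx.1 y hy).asymm hx.2
  rw [cutType, union_inter_distrib_right, union_inter_distrib_right, hS, hS', empty_union]

theorem depthType_union {S T : Set M} (h : ∀ x ∈ S, ∀ y ∈ T, x < y) :
    depthType k (S ∪ T) = depthType k S ++ depthType k T := by
  induction k generalizing S T with
  | zero => rfl
  | succ k ih =>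
    rw [append_succ, truncate_depthType, truncate_depthType, depthType_succ, depthType_succ,
      depthType_succ, image_union, image_image, image_image]
    congr 1
    · refine image_congr fun x hx => ?_
      rw [cutType_union_left h hx, ih fun a ha => h a ha.1, cutType]
    · refine image_congr fun y hy => ?_
      rw [cutType_union_right h hy, ih fun a ha b hb => h a ha b hb.1, cutType]

theorem depthType_inter_Iio_append_Ico (Y : Set M) {a b : M} (h : a ≤ b) :
    depthType k (Y ∩ Iio a) ++ depthType k (Y ∩ Ico a b) = depthType k (Y ∩ Iio b) := by
  rw [← depthType_union fun x hx y hy => (mem_Iio.1 hx.2).trans_le hy.2.1,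
    ← inter_union_distrib_left, Iio_union_Ico_eq_Iio h]

theorem depthType_inter_Ico_append_Ico (Y : Set M) {a b c : M} (h : a ≤ b) (h' : b ≤ c) :
    depthType k (Y ∩ Ico a b) ++ depthType k (Y ∩ Ico b c) = depthType k (Y ∩ Ico a c) := by
  rw [← depthType_union fun x hx y hy => hx.2.2.trans_le hy.2.1, ← inter_union_distrib_left,
    Ico_union_Ico_eq_Ico h h']

theorem depthType_inter_Iio_append_Ici (Y : Set M) (a : M) :
    depthType k (Y ∩ Iio a) ++ depthType k (Y ∩ Ici a) = depthType k Y := by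
  rw [← depthType_union fun x hx y hy => (mem_Iio.1 hx.2).trans_le hy.2,
    ← inter_union_distrib_left, Iio_union_Ici, inter_univ]

theorem depthType_inter_Ioo_append_Ici (Y : Set M) {a b : M} (h : a < b) :
    depthType k (Y ∩ Ioo a b) ++ depthType k (Y ∩ Ici b) = depthType k (Y ∩ Ioi a) := by
  rw [← depthType_union fun x hx y hy => hx.2.2.trans_le hy.2, ← inter_union_distrib_left,
    Ioo_union_Ici_eq_Ioi h]

theorem depthType_inter_Iio_append_singleton {Y : Set M} {m : M} (hm : IsGreatest Y m) :
    depthType k (Y ∩ Iio m) ++ depthType k {m} = depthType k Y := by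
  rw [← depthType_union fun x hx y hy => hy.symm ▸ hx.2]
  congr 1
  ext z
  constructor
  · rintro (hz | rfl)
    exacts [hz.1, hm.1]
  · exact fun hz => (hm.2 hz).lt_or_eq.imp (fun h => ⟨hz, h⟩) fun h => h

theorem omega_depthType_empty (k : ℕ) :
    (depthType k (∅ : Set M)).omega = depthType k (∅ : Set M) := by
  cases k with
  | zero => rfl
  | succ k => rw [depthType_succ, image_empty]; exact image_empty _

/-- `Y` is an unbounded concatenation of blocks of type `t`: the part of `Y` below each point of
`B` has type `t`, and so do the intervals of `Y` from that point to cofinally many points of `B`.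
The cofinality of `Y` may be uncountable, so that the blocks need not form an `ω`-sequence. -/
structure HasCofinalBlocks (t : DepthType k) (Y B : Set M) : Prop where
  nonempty : B.Nonempty
  subset : B ⊆ Y
  initial : ∀ b ∈ B, depthType k (Y ∩ Iio b) = t
  block : ∀ b ∈ B, ∀ y ∈ Y, ∃ c ∈ B, y < c ∧ b < c ∧ depthType k (Y ∩ Ico b c) = t

namespace HasCofinalBlocks

variable {t : DepthType k} {Y B : Set M}

theorem truncate {t : DepthType (k + 1)} (h : HasCofinalBlocks t Y B) :
    HasCofinalBlocks t.truncate Y B where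
  nonempty := h.nonempty
  subset := h.subset
  initial b hb := by rw [← truncate_depthType, h.initial b hb]
  block b hb y hy :=
    let ⟨c, hc, hyc, hbc, e⟩ := h.block b hb y hy
    ⟨c, hc, hyc, hbc, by rw [← truncate_depthType, e]⟩

theorem exists_gt (h : HasCofinalBlocks t Y B) {y : M} (hy : y ∈ Y) : ∃ b ∈ B, y < b :=
  let ⟨b, hb⟩ := h.nonempty
  let ⟨c, hc, hyc, _⟩ := h.block b hb y hy
  ⟨c, hc, hyc⟩

theorem append_self (h : HasCofinalBlocks t Y B) : t ++ t = t := by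
  obtain ⟨b, hb⟩ := h.nonempty
  obtain ⟨c, hc, -, hbc, e⟩ := h.block b hb b (h.subset hb)
  have := depthType_inter_Iio_append_Ico (k := k) Y hbc.le
  rwa [h.initial b hb, e, h.initial c hc] at this

theorem inter_Ici (h : HasCofinalBlocks t Y B) {b : M} (hb : b ∈ B) :
    HasCofinalBlocks t (Y ∩ Ici b) {c ∈ B | b < c ∧ depthType k (Y ∩ Ico b c) = t} where
  nonempty :=
    let ⟨c, hc, _, hbc⟩ := h.block b hb b (h.subset hb)
    ⟨c, hc, hbc⟩
  subset c hc := ⟨h.subset hc.1, hc.2.1.le⟩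
  initial c hc := by rw [inter_assoc, Ici_inter_Iio, hc.2.2]
  block c hc y hy := by
    obtain ⟨d, hd, hyd, hcd, e⟩ := h.block c hc.1 y hy.1
    refine ⟨d, ⟨hd, hc.2.1.trans hcd, ?_⟩, hyd, hcd, ?_⟩
    · rw [← depthType_inter_Ico_append_Ico Y hc.2.1.le hcd.le, hc.2.2, e, h.append_self]
    · rw [inter_assoc, inter_eq_right.2 (Ico_subset_Ici_self.trans (Ici_subset_Ici.2 hc.2.1.le)), e]

theorem depthType_eq (h : HasCofinalBlocks t Y B) : depthType k Y = t.omega := by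
  induction k generalizing Y B with
  | zero => rfl
  | succ k ih =>
    have htail : ∀ b ∈ B, depthType k (Y ∩ Ici b) = t.truncate.omega :=
      fun b hb => ih (h.truncate.inter_Ici hb)
    have hcut : ∀ b ∈ B, ∀ x < b, cutType k Y x =
        ((cutType k (Y ∩ Iio b) x).1, (cutType k (Y ∩ Iio b) x).2 ++ t.truncate.omega) := by
      intro b hb x hxb
      rw [cutType, cutType, inter_assoc, inter_assoc, Iio_inter_Iio, inf_eq_right.2 hxb.le,
        Iio_inter_Ioi, ← htail b hb, depthType_inter_Ioo_append_Ici Y hxb]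
    refine Subset.antisymm ?_ ?_
    · rintro _ ⟨x, hx, rfl⟩
      obtain ⟨b, hb, hxb⟩ := h.exists_gt hx
      refine ⟨cutType k (Y ∩ Iio b) x, ?_, (hcut b hb x hxb).symm⟩
      rw [← h.initial b hb]
      exact mem_image_of_mem _ ⟨hx, hxb⟩
    · obtain ⟨b, hb⟩ := h.nonempty
      rintro _ ⟨p, hp, rfl⟩
      rw [← h.initial b hb] at hp
      obtain ⟨x, hx, rfl⟩ := hp
      exact ⟨x, hx.1, hcut b hb x hx.2⟩

end HasCofinalBlocks

end DepthType

/-! ### The types of the ordinals below `ω ^ ω` -/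

section OrdinalTypes

open Filter in
theorem exists_homogeneous_cofinal {ι C : Type*} [Preorder ι] [IsDirectedOrder ι] [Nonempty ι]
    [NoMaxOrder ι] [Finite C] (f : ι → ι → C) :
    ∃ c a, ∃ B : Set ι, B.Nonempty ∧ (∀ b ∈ B, a < b ∧ f a b = c) ∧
      ∀ b ∈ B, ∀ i, ∃ d ∈ B, i < d ∧ b < d ∧ f b d = c := by
  let U : Ultrafilter ι := .of atTop
  have hgt (i : ι) : ∀ᶠ j in U, i < j := Ultrafilter.of_le _ (eventually_gt_atTop i)
  have hlim (g : ι → C) : ∃ c, ∀ᶠ i in U, g i = c :=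
    Ultrafilter.eventually_exists_iff.1 (.of_forall fun i => ⟨g i, rfl⟩)
  choose g hg using fun i => hlim (f i)
  obtain ⟨c, hc⟩ := hlim g
  have hpair : ∀ᶠ i in U, ∀ᶠ j in U, f i j = c := hc.mono fun i hi => hi ▸ hg i
  obtain ⟨a, ha⟩ := hpair.exists
  have hB : ∀ᶠ b in U, (a < b ∧ f a b = c) ∧ ∀ᶠ d in U, f b d = c :=
    ((hgt a).and ha).and hpair
  refine ⟨c, a, {b | (a < b ∧ f a b = c) ∧ ∀ᶠ d in U, f b d = c}, hB.exists, fun b hb => hb.1,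
    fun b hb i => ?_⟩
  exact (hB.and ((hgt i).and ((hgt b).and hb.2))).exists

open Ordinal

variable {M : Type*} [LinearOrder M] {k : ℕ}

/-- The depth-`k` types of the ordinals below `ω ^ ω`, including the type of `0`. -/
def ordinalTypes (k : ℕ) : Set (DepthType k) :=
  {t | ∃ α : Ordinal.{u}, α < ω ^ ω ∧ depthType k (Iio α) = t}

theorem depthType_Ico_add (α β : Ordinal.{u}) :
    depthType k (Ico α (α + β)) = depthType k (Iio β) := by
  rw [← depthType_image (OrderEmbedding.addLeft α) k (Iio β)]
  congr 1
  ext γ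
  constructor
  · exact fun h => ⟨γ - α, by simpa [Ordinal.sub_lt_of_le h.1] using h.2,
      Ordinal.add_sub_cancel_of_le h.1⟩
  · rintro ⟨δ, hδ, rfl⟩
    exact ⟨le_self_add, add_lt_add_right hδ α⟩

theorem depthType_Iio_add (α β : Ordinal.{u}) :
    depthType k (Iio (α + β)) = depthType k (Iio α) ++ depthType k (Iio β) := by
  rw [← depthType_Ico_add α β, ← depthType_union fun x hx y hy => (mem_Iio.1 hx).trans_le hy.1,
    Iio_union_Ico_eq_Iio le_self_add]

theorem depthType_Iio_mul_succ {β : Ordinal.{u}}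
    (h : depthType k (Iio β) ++ depthType k (Iio β) = depthType k (Iio β)) (n : ℕ) :
    depthType k (Iio (β * (n + 1))) = depthType k (Iio β) := by
  induction n with
  | zero => simp
  | succ n ih => rw [Nat.cast_succ, mul_add_one, depthType_Iio_add, ih, h]

theorem hasCofinalBlocks_mul_omega0 {β : Ordinal.{u}} (hβ : 0 < β)
    (h : depthType k (Iio β) ++ depthType k (Iio β) = depthType k (Iio β)) :
    HasCofinalBlocks (depthType k (Iio β)) (Iio (β * ω)) (range fun n : ℕ => β * (n + 1)) := by
  have hlt (n : ℕ) : β * (n + 1) < β * ω :=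
    mul_lt_mul_of_pos_left (mod_cast natCast_lt_omega0 (n + 1)) hβ
  refine ⟨range_nonempty _, range_subset_iff.2 hlt, ?_, ?_⟩
  · rintro _ ⟨n, rfl⟩
    rw [Iio_inter_Iio, inf_eq_right.2 (hlt n).le, depthType_Iio_mul_succ h]
  · rintro _ ⟨n, rfl⟩ y hy
    obtain ⟨γ, hγ, hyγ⟩ := (lt_mul_iff_of_isSuccLimit isSuccLimit_omega0).1 hy
    obtain ⟨m, rfl⟩ := lt_omega0.1 hγ
    have hadd : β * ((n + m + 1 : ℕ) + 1) = β * (n + 1) + β * (m + 1) := by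
      rw [← mul_add]
      congr 1
      norm_cast
      omega
    refine ⟨_, ⟨n + m + 1, rfl⟩, ?_, ?_, ?_⟩
    · exact hyγ.trans_le (mul_le_mul_right (mod_cast by omega) β)
    · exact mul_lt_mul_of_pos_left (mod_cast by omega) hβ
    · rw [inter_eq_right.2 fun z hz => hz.2.trans (hlt _)]
      dsimp only
      rw [hadd, depthType_Ico_add, depthType_Iio_mul_succ h]

theorem depthType_Iio_mul_omega0 {β : Ordinal.{u}}
    (h : depthType k (Iio β) ++ depthType k (Iio β) = depthType k (Iio β)) :
    depthType k (Iio (β * ω)) = (depthType k (Iio β)).omega := by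
  rcases eq_zero_or_pos β with rfl | hβ
  · rw [zero_mul, ← bot_eq_zero, Iio_bot, omega_depthType_empty]
  · exact (hasCofinalBlocks_mul_omega0 hβ h).depthType_eq

theorem mul_omega0_lt_omega0_opow_omega0 {β : Ordinal.{u}} (h : β < ω ^ ω) :
    β * ω < ω ^ ω := by
  obtain ⟨γ, hγ, hβγ⟩ := (lt_opow_of_isSuccLimit omega0_ne_zero isSuccLimit_omega0).1 h
  calc β * ω ≤ ω ^ γ * ω := mul_le_mul_left hβγ.le ω
    _ = ω ^ Order.succ γ := (opow_succ _ _).symm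
    _ < ω ^ ω := (opow_lt_opow_iff_right one_lt_omega0).2 (isSuccLimit_omega0.succ_lt hγ)

theorem append_mem_ordinalTypes {s t : DepthType k} (hs : s ∈ ordinalTypes.{u} k)
    (ht : t ∈ ordinalTypes.{u} k) : s ++ t ∈ ordinalTypes.{u} k := by
  obtain ⟨α, hα, rfl⟩ := hs
  obtain ⟨β, hβ, rfl⟩ := ht
  exact ⟨α + β, isPrincipal_add_omega0_opow ω hα hβ, depthType_Iio_add α β⟩

theorem omega_mem_ordinalTypes {t : DepthType k} (ht : t ∈ ordinalTypes.{u} k)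
    (h : t ++ t = t) : t.omega ∈ ordinalTypes.{u} k := by
  obtain ⟨β, hβ, rfl⟩ := ht
  exact ⟨β * ω, mul_omega0_lt_omega0_opow_omega0 hβ, depthType_Iio_mul_omega0 h⟩

theorem empty_mem_ordinalTypes : depthType k (∅ : Set M) ∈ ordinalTypes.{u} k :=
  ⟨0, opow_pos _ omega0_pos, by rw [← bot_eq_zero, Iio_bot]; exact depthType_empty k⟩

theorem singleton_mem_ordinalTypes (x : M) : depthType k {x} ∈ ordinalTypes.{u} k :=
  ⟨1, by simp, by rw [show Iio (1 : Ordinal.{u}) = {0} by simp]; exact depthType_singleton k 0 x⟩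

theorem exists_hasCofinalBlocks {Y : Set M} (hne : Y.Nonempty) (hmax : ∀ y ∈ Y, ∃ z ∈ Y, y < z) :
    ∃ a ∈ Y, ∃ b ∈ Y, ∃ B, HasCofinalBlocks (depthType k (Y ∩ Ico a b)) (Y ∩ Ici a) B := by
  have := hne.to_subtype
  have : NoMaxOrder Y := ⟨fun y => let ⟨z, hz, h⟩ := hmax y y.2; ⟨⟨z, hz⟩, h⟩⟩
  have := DepthType.finite k
  obtain ⟨t, a, B, ⟨b, hb⟩, haB, hB⟩ :=
    exists_homogeneous_cofinal fun a b : Y => depthType k (Y ∩ Ico (a : M) b)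
  refine ⟨a, a.2, b, b.2, (↑) '' B, ?_⟩
  rw [(haB b hb).2]
  refine ⟨⟨b, b, hb, rfl⟩, ?_, ?_, ?_⟩
  · rintro _ ⟨c, hc, rfl⟩
    exact ⟨c.2, (haB c hc).1.le⟩
  · rintro _ ⟨c, hc, rfl⟩
    rw [inter_assoc, Ici_inter_Iio, (haB c hc).2]
  · rintro _ ⟨c, hc, rfl⟩ y hy
    obtain ⟨d, hd, hyd, hcd, e⟩ := hB c hc ⟨y, hy.1⟩
    refine ⟨d, ⟨d, hd, rfl⟩, hyd, hcd, ?_⟩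
    have hac : (a : M) ≤ c := (haB c hc).1.le
    rw [inter_assoc, inter_eq_right.2 (Ico_subset_Ici_self.trans (Ici_subset_Ici.2 hac)), e]

theorem depthType_mem_ordinalTypes {Y : Set M}
    (h₁ : ∀ b ∈ Y, depthType k (Y ∩ Iio b) ∈ ordinalTypes.{u} k)
    (h₂ : ∀ a ∈ Y, ∀ b ∈ Y, depthType k (Y ∩ Ico a b) ∈ ordinalTypes.{u} k) :
    depthType k Y ∈ ordinalTypes.{u} k := by
  rcases Y.eq_empty_or_nonempty with rfl | hne
  · exact empty_mem_ordinalTypes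
  by_cases hmax : ∃ m, IsGreatest Y m
  · obtain ⟨m, hm⟩ := hmax
    rw [← depthType_inter_Iio_append_singleton hm]
    exact append_mem_ordinalTypes (h₁ m hm.1) (singleton_mem_ordinalTypes m)
  · have hmax' : ∀ y ∈ Y, ∃ z ∈ Y, y < z := fun y hy => by
      by_contra! h
      exact hmax ⟨y, hy, h⟩
    obtain ⟨a, ha, b, hb, B, hB⟩ := exists_hasCofinalBlocks (k := k) hne hmax'
    rw [← depthType_inter_Iio_append_Ici Y a, hB.depthType_eq]
    exact append_mem_ordinalTypes (h₁ a ha) (omega_mem_ordinalTypes (h₂ a ha b hb) hB.append_self)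

/-- The intervals ending at `x` have the depth-`k` types of ordinals below `ω ^ ω`; this is the
property to which transfinite induction is applied. -/
def HasOrdinalTypes (k : ℕ) (x : M) : Prop :=
  depthType k (Iio x) ∈ ordinalTypes.{u} k ∧ ∀ a, depthType k (Ico a x) ∈ ordinalTypes.{u} k

theorem hasOrdinalTypes_of_forall_lt {x : M} (h : ∀ y < x, HasOrdinalTypes.{u} k y) :
    HasOrdinalTypes.{u} k x := by
  have hIco (a : M) : ∀ b < x, ∀ c, depthType k (Ico a x ∩ Ico c b) ∈ ordinalTypes.{u} k :=
    fun b hb c => by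
      rw [Ico_inter_Ico, min_eq_right hb.le]
      exact (h b hb).2 _
  refine ⟨depthType_mem_ordinalTypes (fun b hb => ?_) fun c _ b hb => ?_, fun a =>
    depthType_mem_ordinalTypes (fun b hb => ?_) fun c _ b hb => hIco a b hb.2 c⟩
  · rw [Iio_inter_Iio, inf_eq_right.2 (mem_Iio.1 hb).le]
    exact (h b hb).1
  · rw [inter_eq_right.2 fun z hz => hz.2.trans hb]
    exact (h b hb).2 c
  · rw [Ico_inter_Iio, min_eq_right hb.2.le]
    exact (h b hb.2).2 a

theorem depthType_univ_mem_ordinalTypes (h : ∀ x : M, HasOrdinalTypes.{u} k x) :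
    depthType k (univ : Set M) ∈ ordinalTypes.{u} k :=
  depthType_mem_ordinalTypes (fun b _ => by simpa using (h b).1)
    fun a _ b _ => by simpa using (h b).2 a

theorem depthType_univ_toType (α : Ordinal.{u}) (k : ℕ) :
    depthType k (univ : Set α.ToType) = depthType k (Iio α) := by
  rw [← depthType_image (ToType.mk.symm.toOrderEmbedding.trans (OrderEmbedding.subtype _))]
  congr 1
  exact (image_univ.trans (ToType.mk.symm.surjective.range_comp _)).trans Subtype.range_coe

end OrdinalTypes

/-! ### The Ehrenfeucht–Fraïssé theorem -/

section Game

variable {M N : Type*} {n k : ℕ}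

theorem strictOrder_term_eq_var {α : Type*} (t : strictOrder.Term α) : ∃ a, t = Term.var a := by
  cases t with
  | var a => exact ⟨a, rfl⟩
  | func f _ => exact f.elim

theorem realize_ltSymb [LT M] {α : Type*} {t₁ t₂ : strictOrder.Term (α ⊕ Fin n)} {v : α → M}
    {xs : Fin n → M} : (ltSymb.boundedFormula₂ t₁ t₂).Realize v xs ↔
      t₁.realize (Sum.elim v xs) < t₂.realize (Sum.elim v xs) :=
  BoundedFormula.realize_rel₂

variable [LinearOrder M] [LinearOrder N]

/-- The interval cut out by the tuple `xs`, of points above `xs i` for `i ∈ c` and below `xs i` for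
`i ∉ c`. -/
def cutSet (xs : Fin n → M) (c : Set (Fin n)) : Set M :=
  {z | ∀ i, (i ∈ c → xs i < z) ∧ (i ∉ c → z < xs i)}

variable {xs : Fin n → M} {ys : Fin n → N} {c : Set (Fin n)} {i : Fin n} {x : M} {y : N}

theorem lt_iff_mem_of_mem_cutSet (hx : x ∈ cutSet xs c) (i : Fin n) : xs i < x ↔ i ∈ c :=
  ⟨fun h => by_contra fun hi => h.asymm ((hx i).2 hi), (hx i).1⟩

theorem gt_iff_notMem_of_mem_cutSet (hx : x ∈ cutSet xs c) (i : Fin n) : x < xs i ↔ i ∉ c :=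
  ⟨fun h hi => h.asymm ((hx i).1 hi), (hx i).2⟩

theorem exists_mem_cutSet_or_eq (xs : Fin n → M) (x : M) :
    (∃ c, x ∈ cutSet xs c) ∨ ∃ i, xs i = x :=
  or_iff_not_imp_right.2 fun h => ⟨{i | xs i < x}, fun i => ⟨id, fun hi =>
    (not_lt.1 hi).lt_of_ne fun e => h ⟨i, e.symm⟩⟩⟩

theorem cutType_cutSet_of_mem (hi : i ∈ c) (hx : x ≤ xs i) :
    cutType k (cutSet xs c) x = (depthType k (∅ : Set M), depthType k (cutSet xs c)) := by
  have hlt : cutSet xs c ⊆ Ioi x := fun z hz => hx.trans_lt ((hz i).1 hi)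
  have hempty : cutSet xs c ∩ Iio x = ∅ :=
    eq_empty_of_forall_notMem fun z hz => (mem_Ioi.1 (hlt hz.1)).asymm hz.2
  rw [cutType, inter_eq_left.2 hlt, hempty]

theorem cutType_cutSet_of_notMem (hi : i ∉ c) (hx : xs i ≤ x) :
    cutType k (cutSet xs c) x = (depthType k (cutSet xs c), depthType k (∅ : Set M)) := by
  have hlt : cutSet xs c ⊆ Iio x := fun z hz => ((hz i).2 hi).trans_le hx
  have hempty : cutSet xs c ∩ Ioi x = ∅ :=
    eq_empty_of_forall_notMem fun z hz => (mem_Iio.1 (hlt hz.1)).asymm hz.2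
  rw [cutType, inter_eq_left.2 hlt, hempty]

theorem cutType_cutSet_congr (hlt : ∀ i, xs i < x ↔ ys i < y) (hgt : ∀ i, x < xs i ↔ y < ys i)
    (hx : x ∉ cutSet xs c) (h : depthType k (cutSet xs c) = depthType k (cutSet ys c)) :
    cutType k (cutSet xs c) x = cutType k (cutSet ys c) y := by
  obtain ⟨i, hi⟩ := not_forall.1 hx
  by_cases hic : i ∈ c
  · have hxi : x ≤ xs i := not_lt.1 fun hn => hi ⟨fun _ => hn, fun hn => absurd hic hn⟩
    have hyi : y ≤ ys i := by rwa [← not_lt, ← hlt, not_lt]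
    rw [cutType_cutSet_of_mem hic hxi, cutType_cutSet_of_mem hic hyi, h,
      depthType_empty (M := M) (N := N)]
  · have hxi : xs i ≤ x := not_lt.1 fun hn => hi ⟨fun h => absurd h hic, fun _ => hn⟩
    have hyi : ys i ≤ y := by rwa [← not_lt, ← hgt, not_lt]
    rw [cutType_cutSet_of_notMem hic hxi, cutType_cutSet_of_notMem hic hyi, h,
      depthType_empty (M := M) (N := N)]

open Classical in
theorem cutSet_snoc (xs : Fin n → M) (x : M) (c : Set (Fin (n + 1))) :
    cutSet (Fin.snoc xs x : Fin (n + 1) → M) c =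
      cutSet xs {i | i.castSucc ∈ c} ∩ if Fin.last n ∈ c then Ioi x else Iio x := by
  ext z
  simp only [cutSet, mem_ofPred_eq, Fin.forall_fin_succ', Fin.snoc_castSucc, Fin.snoc_last,
    mem_inter_iff]
  split_ifs with h <;> simp [h]

/-- The tuples `xs` and `ys` are ordered in the same way, and corresponding intervals between them
have the same depth-`k` types: a winning position for Duplicator in the Ehrenfeucht–Fraïssé game
with `k` rounds left. -/
structure GameEquiv (k : ℕ) (xs : Fin n → M) (ys : Fin n → N) : Prop where
  lt_iff : ∀ i j, xs i < xs j ↔ ys i < ys j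
  depthType_cutSet : ∀ c, depthType k (cutSet xs c) = depthType k (cutSet ys c)

namespace GameEquiv

theorem symm (h : GameEquiv k xs ys) : GameEquiv k ys xs :=
  ⟨fun i j => (h.lt_iff i j).symm, fun c => (h.depthType_cutSet c).symm⟩

theorem eq_iff (h : GameEquiv k xs ys) (i j : Fin n) : xs i = xs j ↔ ys i = ys j := by
  rw [eq_iff_le_not_lt, eq_iff_le_not_lt, ← not_lt, ← not_lt, h.lt_iff, h.lt_iff]

theorem snoc (h : ∀ i j, xs i < xs j ↔ ys i < ys j) (hlt : ∀ i, xs i < x ↔ ys i < y)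
    (hgt : ∀ i, x < xs i ↔ y < ys i)
    (hcut : ∀ c, cutType k (cutSet xs c) x = cutType k (cutSet ys c) y) :
    GameEquiv k (Fin.snoc xs x : Fin (n + 1) → M) (Fin.snoc ys y : Fin (n + 1) → N) where
  lt_iff i j := by
    induction i using Fin.lastCases <;> induction j using Fin.lastCases <;>
      simp [h, hlt, hgt]
  depthType_cutSet c := by
    rw [cutSet_snoc, cutSet_snoc]
    obtain ⟨hleft, hright⟩ := Prod.ext_iff.1 (hcut {i | i.castSucc ∈ c})
    split_ifs
    exacts [hright, hleft]

theorem exists_snoc (h : GameEquiv (k + 1) xs ys) (x : M) :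
    ∃ y, GameEquiv k (Fin.snoc xs x : Fin (n + 1) → M) (Fin.snoc ys y : Fin (n + 1) → N) := by
  have hk : ∀ c, depthType k (cutSet xs c) = depthType k (cutSet ys c) :=
    fun c => depthType_eq_of_succ (h.depthType_cutSet c)
  rcases exists_mem_cutSet_or_eq xs x with ⟨c, hx⟩ | ⟨i, rfl⟩
  · obtain ⟨y, hy, hxy⟩ := exists_cutType_eq_of_depthType_succ_eq (h.depthType_cutSet c) hx
    have hlt (i : Fin n) : xs i < x ↔ ys i < y := by
      rw [lt_iff_mem_of_mem_cutSet hx, lt_iff_mem_of_mem_cutSet hy]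
    have hgt (i : Fin n) : x < xs i ↔ y < ys i := by
      rw [gt_iff_notMem_of_mem_cutSet hx, gt_iff_notMem_of_mem_cutSet hy]
    refine ⟨y, snoc h.lt_iff hlt hgt fun d => ?_⟩
    by_cases hd : x ∈ cutSet xs d
    · have hdc : d = c := Set.ext fun i => by
        rw [← lt_iff_mem_of_mem_cutSet hd, ← lt_iff_mem_of_mem_cutSet hx]
      rw [hdc, hxy]
    · exact cutType_cutSet_congr hlt hgt hd (hk d)
  · have hi (d : Set (Fin n)) : xs i ∉ cutSet xs d := fun hd =>
      iff_not_self ((lt_iff_mem_of_mem_cutSet hd i).symm.trans (gt_iff_notMem_of_mem_cutSet hd i))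
    exact ⟨ys i, snoc h.lt_iff (h.lt_iff · i) (h.lt_iff i ·) fun d =>
      cutType_cutSet_congr (h.lt_iff · i) (h.lt_iff i ·) (hi d) (hk d)⟩

theorem realize_iff {φ : strictOrder.BoundedFormula Empty n} (hφ : quantifierRank φ ≤ k)
    (h : GameEquiv k xs ys) (v : Empty → M) (w : Empty → N) :
    φ.Realize v xs ↔ φ.Realize w ys := by
  have hvar {n : ℕ} (t : strictOrder.Term (Empty ⊕ Fin n)) : ∃ i, t = Term.var (Sum.inr i) := by
    obtain ⟨a | i, rfl⟩ := strictOrder_term_eq_var t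
    exacts [a.elim, ⟨i, rfl⟩]
  induction φ generalizing k with
  | falsum => exact Iff.rfl
  | equal t₁ t₂ =>
    obtain ⟨i, rfl⟩ := hvar t₁
    obtain ⟨j, rfl⟩ := hvar t₂
    exact h.eq_iff i j
  | rel R ts =>
    cases R
    obtain ⟨i, hi⟩ := hvar (ts 0)
    obtain ⟨j, hj⟩ := hvar (ts 1)
    change (ts 0).realize (Sum.elim v xs) < (ts 1).realize (Sum.elim v xs) ↔
      (ts 0).realize (Sum.elim w ys) < (ts 1).realize (Sum.elim w ys)
    rw [hi, hj]
    exact h.lt_iff i j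
  | imp φ ψ ihφ ihψ =>
    obtain ⟨hφ, hψ⟩ := max_le_iff.1 hφ
    exact imp_congr (ihφ hφ h) (ihψ hψ h)
  | all φ ih =>
    obtain ⟨k, rfl⟩ := Nat.exists_eq_succ_of_ne_zero (Nat.ne_zero_of_lt hφ)
    refine ⟨fun H y => ?_, fun H x => ?_⟩
    · obtain ⟨x, hx⟩ := h.symm.exists_snoc y
      exact (ih (Nat.le_of_succ_le_succ hφ) hx.symm).1 (H x)
    · obtain ⟨y, hy⟩ := h.exists_snoc x
      exact (ih (Nat.le_of_succ_le_succ hφ) hy).2 (H y)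

end GameEquiv

theorem realize_sentence_iff_of_depthType_eq {φ : strictOrder.Sentence}
    (hφ : quantifierRank φ ≤ k) (h : depthType k (univ : Set M) = depthType k (univ : Set N)) :
    M ⊨ φ ↔ N ⊨ φ := by
  have hM (xs : Fin 0 → M) (c : Set (Fin 0)) : cutSet xs c = univ :=
    eq_univ_of_forall fun _ i => i.elim0
  have hN (ys : Fin 0 → N) (c : Set (Fin 0)) : cutSet ys c = univ :=
    eq_univ_of_forall fun _ i => i.elim0
  exact GameEquiv.realize_iff hφ ⟨fun i => i.elim0, fun c => by rw [hM, hN, h]⟩ _ _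

end Game

/-! ### Definability of depth types -/

section Definability

open Sum

variable {M : Type*} [LinearOrder M] {α β : Type*} {A : Set M}

theorem definable_lt (i j : α) : A.Definable strictOrder {v : α → M | v i < v j} :=
  (empty_definable_iff.2 ⟨ltSymb.formula₂ (Term.var i) (Term.var j),
    Set.ext fun _ => Formula.realize_rel₂.symm⟩).mono (empty_subset A)

theorem definable_exists {s : Set (α ⊕ Unit → M)} (hs : A.Definable strictOrder s) :
    A.Definable strictOrder {v | ∃ x, Sum.elim v (fun _ => x) ∈ s} := by
  have h := hs.exists_of_finite
  simp only [(Equiv.funUnique Unit M).exists_congr_left] at h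
  exact h

theorem definable_forall {s : Set (α ⊕ Unit → M)} (hs : A.Definable strictOrder s) :
    A.Definable strictOrder {v | ∀ x, Sum.elim v (fun _ => x) ∈ s} := by
  have h := hs.forall_of_finite
  simp only [(Equiv.funUnique Unit M).forall_congr_left] at h
  exact h

/-- The sets `S v` are uniformly definable in `v`, with the element of `S v` as an additional
variable. -/
def IsDefinableFamily (A : Set M) (S : (α → M) → Set M) : Prop :=
  A.Definable strictOrder {v : α ⊕ Unit → M | v (inr ()) ∈ S (v ∘ inl)}

theorem isDefinableFamily_Iio (i : α) : IsDefinableFamily A fun v => Iio (v i) :=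
  definable_lt (inr ()) (inl i)

theorem isDefinableFamily_Ioi (i : α) : IsDefinableFamily A fun v => Ioi (v i) :=
  definable_lt (inl i) (inr ())

theorem isDefinableFamily_Ico (i j : α) : IsDefinableFamily A fun v => Ico (v i) (v j) := by
  simp only [IsDefinableFamily, mem_Ico, ← not_lt]
  exact (definable_lt (inr ()) (inl i)).compl.inter (definable_lt (inr ()) (inl j))

namespace IsDefinableFamily

variable {S T : (α → M) → Set M} {k : ℕ}

theorem inter (hS : IsDefinableFamily A S) (hT : IsDefinableFamily A T) :
    IsDefinableFamily A fun v => S v ∩ T v :=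
  Definable.inter hS hT

theorem comp (hS : IsDefinableFamily A S) (f : α → β) :
    IsDefinableFamily A fun v => S (v ∘ f) :=
  Definable.preimage_comp (Sum.map f id) hS

theorem depthType_eq (hS : IsDefinableFamily A S) (t : DepthType k) :
    A.Definable strictOrder {v | depthType k (S v) = t} := by
  induction k generalizing α with
  | zero => exact (eq_univ_of_forall fun _ => rfl) ▸ definable_univ
  | succ k ih =>
    have hcut (p : DepthType k × DepthType k) :
        A.Definable strictOrder {v | p ∈ cutType k (S v) '' S v} := by
      have hleft := ih ((hS.comp inl).inter (isDefinableFamily_Iio (inr ()))) p.1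
      have hright := ih ((hS.comp inl).inter (isDefinableFamily_Ioi (inr ()))) p.2
      simp only [mem_image, Prod.ext_iff]
      exact definable_exists (Definable.inter hS (hleft.inter hright))
    have := DepthType.finite k
    obtain ⟨s, rfl⟩ : ∃ s : Set (DepthType k × DepthType k), s = t := ⟨t, rfl⟩
    have heq : {v | depthType (k + 1) (S v) = s} =
        ⋂ p, {v | p ∈ cutType k (S v) '' S v ↔ p ∈ s} := by
      ext v
      rw [mem_iInter]
      exact Set.ext_iff
    rw [heq]
    refine definable_iInter_of_finite fun p => ?_
    by_cases hp : p ∈ s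
    · simpa only [hp, iff_true] using hcut p
    · simp only [hp, iff_false]
      exact (hcut p).compl

theorem depthType_mem (hS : IsDefinableFamily A S) (B : Set (DepthType k)) :
    A.Definable strictOrder {v | depthType k (S v) ∈ B} := by
  have := DepthType.finite k
  have hB : {v | depthType k (S v) ∈ B} = ⋃ t : B, {v | depthType k (S v) = t} := by
    ext v
    simp
  rw [hB]
  exact definable_iUnion_of_finite fun t => hS.depthType_eq t.1

end IsDefinableFamily

theorem definable_hasOrdinalTypes (k : ℕ) :
    A.Definable₁ strictOrder {x : M | HasOrdinalTypes.{u} k x} := by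
  have hIio : IsDefinableFamily A fun v : Fin 1 → M => Iio (v 0) := isDefinableFamily_Iio 0
  have hIco : IsDefinableFamily A fun v : Fin 1 ⊕ Unit → M => Ico (v (inr ())) (v (inl 0)) :=
    isDefinableFamily_Ico (inr ()) (inl 0)
  exact (hIio.depthType_mem (ordinalTypes k)).inter
    (definable_forall (hIco.depthType_mem (ordinalTypes k)))

end Definability

/-! ### Models of transfinite induction -/

section TransfiniteInduction

variable {M : Type*}

theorem model_strictLinearOrderTheory_iff [LT M] :
    M ⊨ strictLinearOrderTheory ↔ Std.Irrefl (α := M) (· < ·) ∧ IsTrans M (· < ·) ∧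
      ∀ a b : M, a < b ∨ a = b ∨ b < a := by
  simp only [strictLinearOrderTheory, Theory.model_iff, mem_insert_iff, mem_singleton_iff,
    forall_eq_or_imp, forall_eq]
  refine and_congr Relations.realize_irreflexive (and_congr Relations.realize_transitive ?_)
  simp only [Sentence.Realize, Formula.Realize, BoundedFormula.realize_all,
    BoundedFormula.realize_sup, realize_ltSymb, BoundedFormula.realize_bdEqual]
  rfl

theorem exists_linearOrder_of_model [S : strictOrder.Structure M]
    (h : M ⊨ strictLinearOrderTheory) : ∃ o : LinearOrder M, strictOrderStructure M = S := by
  obtain ⟨_, rfl⟩ : ∃ o : LT M, strictOrderStructure M = S := by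
    refine ⟨⟨fun a b => Structure.RelMap ltSymb ![a, b]⟩,
      Structure.ext (funext₂ fun n f => f.elim) (funext₂ fun n R => funext fun xs => ?_)⟩
    cases R
    exact congrArg (S.RelMap ltSymb) (funext (Fin.forall_fin_two.2 ⟨rfl, rfl⟩))
  obtain ⟨_, _, htri⟩ := model_strictLinearOrderTheory_iff.1 h
  have : Std.Trichotomous (α := M) (· < ·) :=
    ⟨fun a b hab hba => ((htri a b).resolve_left hab).resolve_right hba⟩
  have : IsStrictTotalOrder M (· < ·) := {}
  classical exact ⟨linearOrderOfSTO (· < ·), rfl⟩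

theorem realize_transfiniteInduction [LT M] {n : ℕ} (φ : strictOrder.BoundedFormula Empty (n + 1)) :
    M ⊨ transfiniteInduction φ ↔ ∀ xs : Fin n → M,
      (∀ x, (∀ y < x, φ.Realize default (Fin.snoc xs y : Fin (n + 1) → M)) →
        φ.Realize default (Fin.snoc xs x : Fin (n + 1) → M)) →
      ∀ x, φ.Realize default (Fin.snoc xs x : Fin (n + 1) → M) := by
  have hlift (xs : Fin n → M) (x y : M) : (φ.liftAt 1 n).Realize (default : Empty → M)
      (Fin.snoc (Fin.snoc xs x : Fin (n + 1) → M) y : Fin (n + 1 + 1) → M) ↔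
        φ.Realize default (Fin.snoc xs y : Fin (n + 1) → M) := by
    rw [BoundedFormula.realize_liftAt (by omega)]
    refine iff_of_eq (congrArg _ (funext fun i => ?_))
    induction i using Fin.lastCases with
    | last =>
      simp only [Function.comp, Fin.val_last, lt_irrefl, if_false, Fin.snoc_last]
      exact Fin.snoc_last (α := fun _ => M) y _
    | cast i =>
      simp only [Function.comp, Fin.val_castSucc, i.2, if_true, Fin.snoc_castSucc]
      exact (Fin.snoc_castSucc (α := fun _ => M) _ _ i.castSucc).trans
        (Fin.snoc_castSucc (α := fun _ => M) _ _ i)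
  rw [transfiniteInduction, Sentence.Realize, BoundedFormula.realize_alls]
  refine forall_congr' fun xs => ?_
  simp only [BoundedFormula.realize_imp, BoundedFormula.realize_all, realize_ltSymb, hlift,
    Function.comp_apply, Term.realize_var, Sum.elim_inr, Fin.snoc_last, Fin.snoc_castSucc]

theorem model_transfiniteInductionTheory (M : Type*) [LinearOrder M] [WellFoundedLT M] :
    M ⊨ transfiniteInductionTheory := by
  refine Theory.Model.union
    (model_strictLinearOrderTheory_iff.2 ⟨inferInstance, inferInstance, lt_trichotomy⟩) ⟨?_⟩
  rintro _ ⟨n, φ, rfl⟩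
  exact (realize_transfiniteInduction φ).2 fun xs h x => WellFoundedLT.induction x h

theorem mem_of_forall_lt_mem [LinearOrder M] [M ⊨ transfiniteInductionTheory] {A P : Set M}
    (hP : A.Definable₁ strictOrder P) (h : ∀ x, (∀ y < x, y ∈ P) → x ∈ P) (x : M) : x ∈ P := by
  obtain ⟨A₀, -, hA₀⟩ := definable_iff_finitely_definable.1 hP
  obtain ⟨φ, hφ⟩ := definable_iff_exists_formula_sum.1 hA₀
  let e := A₀.equivFin
  let xs : Fin A₀.card → M := fun i => e.symm i
  let g : A₀ ⊕ Fin 1 → Empty ⊕ Fin (A₀.card + 1) :=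
    Sum.inr ∘ Sum.elim (fun a => (e a).castSucc) fun _ => Fin.last A₀.card
  let ψ : strictOrder.BoundedFormula Empty (A₀.card + 1) := BoundedFormula.relabel g φ
  have hψ (y : M) : ψ.Realize default (Fin.snoc xs y : Fin (A₀.card + 1) → M) ↔ y ∈ P := by
    have hφy : φ.Realize (Sum.elim (↑) fun _ => y) ↔ y ∈ P :=
      iff_of_eq (congrArg ((fun _ : Fin 1 => y) ∈ ·) hφ.symm)
    rw [← hφy, BoundedFormula.realize_relabel]
    refine iff_of_eq (congrArg₂ _ (funext ?_) (Subsingleton.elim _ _))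
    rintro (a | _)
    · simp [g, xs]
    · simp [g]
  have hind := (realize_transfiniteInduction ψ).1
    (Theory.realize_sentence_of_mem transfiniteInductionTheory (.inr ⟨_, ψ, rfl⟩)) xs
  simp only [hψ] at hind
  exact hind h x

theorem exists_ordinal_depthType_eq (M : Type*) [LinearOrder M] [M ⊨ transfiniteInductionTheory]
    (k : ℕ) : ∃ α : Ordinal.{u}, α < Ordinal.omega0 ^ Ordinal.omega0 ∧
      depthType k (univ : Set α.ToType) = depthType k (univ : Set M) := by
  obtain ⟨α, hα, e⟩ := depthType_univ_mem_ordinalTypes.{u} fun x : M =>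
    mem_of_forall_lt_mem (definable_hasOrdinalTypes (A := ∅) k)
      (fun _ => hasOrdinalTypes_of_forall_lt) x
  exact ⟨α, hα, (depthType_univ_toType α k).trans e⟩

end TransfiniteInduction

instance : Countable strictOrder.Symbols := by
  have : Countable (Σ n, strictOrder.Functions n) :=
    ⟨fun x => Empty.elim x.2, fun x => Empty.elim x.2⟩
  have : Countable (Σ n, strictOrder.Relations n) := ⟨fun _ => 0, fun ⟨_, .lt⟩ ⟨_, .lt⟩ _ => rfl⟩
  exact inferInstanceAs (Countable (_ ⊕ _))

theorem realize_of_model_transfiniteInductionTheory {φ : strictOrder.Sentence}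
    (h : ∀ α : Ordinal.{u}, 0 < α → α < Ordinal.omega0 ^ Ordinal.omega0 → α.ToType ⊨ φ)
    {M : Type*} [S : strictOrder.Structure M] [Nonempty M] (hM : M ⊨ transfiniteInductionTheory) :
    M ⊨ φ := by
  obtain ⟨o, rfl⟩ := exists_linearOrder_of_model (hM.mono subset_union_left)
  obtain ⟨α, hα, e⟩ := exists_ordinal_depthType_eq M (quantifierRank φ + 1)
  obtain ⟨a, -⟩ :=
    exists_cutType_eq_of_depthType_succ_eq e.symm (mem_univ (Classical.arbitrary M))
  have hα₀ : α ≠ 0 := Ordinal.nonempty_toType_iff.1 ⟨a⟩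
  exact (realize_sentence_iff_of_depthType_eq le_rfl (depthType_eq_of_succ e)).1
    (h α (pos_iff_ne_zero.2 hα₀) hα)

open FirstOrder FirstOrder.Language in
theorem theorem1 (φ : strictOrder.Sentence) :
    [ ∀ (M : Type u) [LinearOrder M] [WellFoundedLT M] [Nonempty M], M ⊨ φ,
      ∀ α : Ordinal.{u}, 0 < α → α < Ordinal.omega0 ^ Ordinal.omega0 → α.ToType ⊨ φ,
      transfiniteInductionTheory.Proves φ ].TFAE := by
  tfae_have 1 → 2 := fun h α hα _ =>
    have := Ordinal.nonempty_toType_iff.2 hα.ne'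
    h α.ToType
  tfae_have 2 → 3 := fun h => proves_iff_models.2 <| Theory.models_sentence_iff.2 fun M =>
    realize_of_model_transfiniteInductionTheory h M.is_model
  tfae_have 3 → 1 := fun h M _ _ _ =>
    have := model_transfiniteInductionTheory M
    realize_of_proves h M
  tfae_finish
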